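/- Let $\{1,\dots,p\}=\bigcup_{j=1}^m G_j$ with $G_1,\dots,G_m$ pairwise disjoint, and for $S\subset\{1,\dots,m\}$ put $G_S=\bigcup_{j\in S}G_j$. A vector $\beta\in\mathbb{R}^p$ is called $(g,k)$ strongly group-sparse if there is a set $S\subset\{1,\dots,m\}$ with $\mathrm{supp}(\beta)\subset G_S$, $|G_S|\le k$ and $|S|\le g$. Let $X\in\mathbb{R}^{n\times p}$ be a random matrix whose entries are independent standard Gaussian $N(0,1)$ random variables. Let $t>0$, $\delta\in(0,1)$, let $g,k\ge 0$ be integers with $g\le m$, and suppose that \[ n \;\ge\; \frac{8}{\delta^2}\Bigl[\ln 3 + t + k\ln(1+8/\delta) + g\ln(em/g)\Bigr], \] where the last term is read as $0$ if $g=0$. Then with probability at least $1-e^{-t}$ the following holds simultaneously for all $(g,k)$ strongly group-sparse vectors $\beta\in\mathbb{R}^p$: \[ (1-\delta)\|\beta\|_2 \;\le\; \frac{1}{\sqrt n}\|X\beta\|_2 \;\le\; (1+\delta)\|\beta\|_2 . \] -/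

import Mathlib

open MeasureTheory ProbabilityTheory
open scoped Matrix

/-- The set of variables `G_S = ⋃_{j ∈ S} G_j` covered by a set `S` of groups. -/
def groupUnion {p m : ℕ} (G : Fin m → Finset (Fin p)) (S : Finset (Fin m)) : Finset (Fin p) :=
  S.biUnion G

/-- `β ∈ ℝ^p` is `(g, k)` strongly group-sparse with respect to the groups `G_1, …, G_m`: some set
`S` of at most `g` groups, covering at most `k` variables in total, contains the support of `β`. -/
def StronglyGroupSparse {p m : ℕ} (G : Fin m → Finset (Fin p)) (g k : ℕ)
    (β : EuclideanSpace ℝ (Fin p)) : Prop :=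
  ∃ S : Finset (Fin m),
    Function.support (fun i => β i) ⊆ (groupUnion G S : Set (Fin p)) ∧
      (groupUnion G S).card ≤ k ∧ S.card ≤ g

/-- The product `A β`, as a vector of `ℝ^n` with the Euclidean norm. -/
noncomputable def euclideanMulVec {n p : ℕ} (A : Matrix (Fin n) (Fin p) ℝ)
    (β : EuclideanSpace ℝ (Fin p)) : EuclideanSpace ℝ (Fin n) :=
  WithLp.toLp 2 (A *ᵥ (fun j => β j))

/-- The group-RIP inequality for the matrix `A`, uniformly over all `(g, k)` strongly group-sparse
vectors. -/
def GroupRIP {n p m : ℕ} (G : Fin m → Finset (Fin p)) (g k : ℕ) (δ : ℝ)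
    (A : Matrix (Fin n) (Fin p) ℝ) : Prop :=
  ∀ β : EuclideanSpace ℝ (Fin p), StronglyGroupSparse G g k β →
    (1 - δ) * ‖β‖ ≤ 1 / √(n : ℝ) * ‖euclideanMulVec A β‖ ∧
      1 / √(n : ℝ) * ‖euclideanMulVec A β‖ ≤ (1 + δ) * ‖β‖

/-! Strongly group-sparse vectors fill at most `(e m / g) ^ g` coordinate subspaces (one if `g =
0`), each of dimension at most `k` (`card_filter_card_le_exp`), and the unit sphere of each has a `δ
/ 4`-net of at most `(1 + 8 / δ) ^ k` points. For a fixed unit `β` the entries of `X β` are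
independent standard Gaussians, so `‖X β‖ ^ 2` is chi-squared and `‖X β‖ / √n` leaves `[1 - δ / 2, 1
+ δ / 2]` with probability at most `2 exp (-n δ ^ 2 / 8)` (`measureReal_norm_euclideanMulVec_le`).
The lower bound on `n` pays for a union bound over all net points; `almostIsometry_of_net` then
passes deterministically from the nets to the subspaces. -/

section Nets

variable {E F : Type*} [NormedAddCommGroup E] [NormedSpace ℝ E] [FiniteDimensional ℝ E]
  [NormedAddCommGroup F] [NormedSpace ℝ F]

open Metric Module in
/-- Volume bound for the cardinality of an `ε`-separated subset of the unit ball. -/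
theorem card_le_of_separated_unitBall {ε : ℝ} (hε : 0 < ε) (s : Finset E)
    (hs : ∀ c ∈ s, ‖c‖ ≤ 1) (h : ∀ c ∈ s, ∀ d ∈ s, c ≠ d → ε ≤ ‖c - d‖) :
    (s.card : ℝ) ≤ (1 + 2 / ε) ^ finrank ℝ E := by
  borelize E
  let μ : Measure E := Measure.addHaar
  have hε2 : 0 < ε / 2 := by positivity
  have hρ : 0 < 1 + ε / 2 := by positivity
  -- Disjoint balls of radius `ε / 2` fit in one of radius `1 + ε / 2`; comparing volumes bounds
  -- their number.
  have hdisj : Set.Pairwise (s : Set E) (Function.onFun Disjoint fun c => ball (c : E) (ε / 2)) := by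
    rintro c hc d hd hcd
    apply ball_disjoint_ball
    rw [dist_eq_norm, add_halves]
    exact h c hc d hd hcd
  have hsub : (⋃ c ∈ s, ball (c : E) (ε / 2)) ⊆ ball (0 : E) (1 + ε / 2) := by
    refine Set.iUnion₂_subset fun x hx => ball_subset_ball' ?_
    rw [dist_zero_right, add_comm]
    exact add_le_add (hs x hx) le_rfl
  have hvol : (s.card : ENNReal) * ENNReal.ofReal ((ε / 2) ^ finrank ℝ E) * μ (ball 0 1) ≤
      ENNReal.ofReal ((1 + ε / 2) ^ finrank ℝ E) * μ (ball 0 1) := by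
    rw [← μ.addHaar_ball_of_pos _ hρ]
    refine le_trans (le_of_eq ?_) (measure_mono hsub)
    rw [measure_biUnion_finset hdisj fun c _ => measurableSet_ball]
    simp only [μ.addHaar_ball_of_pos _ hε2, Finset.sum_const, nsmul_eq_mul, mul_assoc]
  have hcard := (ENNReal.mul_le_mul_iff_left (measure_ball_pos _ _ zero_lt_one).ne'
    measure_ball_lt_top.ne).1 hvol
  have hcard' : (s.card : ℝ) * (ε / 2) ^ finrank ℝ E ≤ (1 + ε / 2) ^ finrank ℝ E := by
    have := ENNReal.toReal_le_of_le_ofReal (pow_nonneg hρ.le _) hcard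
    rwa [ENNReal.toReal_mul, ENNReal.toReal_natCast,
      ENNReal.toReal_ofReal (pow_nonneg hε2.le _)] at this
  rw [← le_div_iff₀ (pow_pos hε2 _), ← div_pow] at hcard'
  rwa [add_div, div_self hε2.ne', one_div_div, add_comm] at hcard'

/-- The unit sphere of a finite-dimensional normed space has an `ε`-net of at most
`(1 + 2 / ε) ^ d` points. -/
theorem exists_finset_net_unitSphere {ε : ℝ} (hε : 0 < ε) :
    ∃ s : Finset E, (∀ c ∈ s, ‖c‖ = 1) ∧ (∀ x : E, ‖x‖ = 1 → ∃ c ∈ s, ‖x - c‖ ≤ ε) ∧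
      (s.card : ℝ) ≤ (1 + 2 / ε) ^ Module.finrank ℝ E := by
  classical
  let separated : Set (Finset E) :=
    {s | (∀ c ∈ s, ‖c‖ = 1) ∧ ∀ c ∈ s, ∀ d ∈ s, c ≠ d → ε ≤ ‖c - d‖}
  have hcard : ∀ s ∈ separated, (s.card : ℝ) ≤ (1 + 2 / ε) ^ Module.finrank ℝ E := fun s hs =>
    card_le_of_separated_unitBall hε s (fun c hc => (hs.1 c hc).le) hs.2
  have hbdd : BddAbove (Finset.card '' separated) := by
    refine ⟨⌊(1 + 2 / ε) ^ Module.finrank ℝ E⌋₊, ?_⟩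
    rintro _ ⟨s, hs, rfl⟩
    exact Nat.le_floor (hcard s hs)
  have hne : (Finset.card '' separated).Nonempty := ⟨0, ∅, by simp [separated], rfl⟩
  -- A separated set of maximal cardinality is a net: a point far from all of it could be added.
  obtain ⟨s, hs, hmax⟩ := Nat.sSup_mem hne hbdd
  refine ⟨s, hs.1, fun x hx => ?_, hcard s hs⟩
  by_contra! hfar
  have hxs : x ∉ s := fun hxs => by
    have := hfar x hxs
    rw [sub_self, norm_zero] at this
    exact this.not_gt hε
  have hins : insert x s ∈ separated := by
    refine ⟨fun c hc => ?_, fun c hc d hd hcd => ?_⟩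
    · rcases Finset.mem_insert.1 hc with rfl | hc
      exacts [hx, hs.1 c hc]
    · rcases Finset.mem_insert.1 hc with rfl | hcs <;> rcases Finset.mem_insert.1 hd with rfl | hds
      · exact absurd rfl hcd
      · exact (hfar d hds).le
      · rw [norm_sub_rev]
        exact (hfar c hcs).le
      · exact hs.2 c hcs d hds hcd
  have := le_csSup hbdd ⟨_, hins, rfl⟩
  rw [← hmax, Finset.card_insert_of_notMem hxs] at this
  omega

/-- A linear map that is a `δ / 2`-almost isometry on a `δ / 4`-net of the unit sphere is a
`δ`-almost isometry everywhere. -/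
theorem almostIsometry_of_net {δ : ℝ} (hδ0 : 0 < δ) (hδ1 : δ < 1) (A : E →ₗ[ℝ] F) {s : Set E}
    (hs : ∀ x : E, ‖x‖ = 1 → ∃ c ∈ s, ‖x - c‖ ≤ δ / 4)
    (hA : ∀ c ∈ s, 1 - δ / 2 ≤ ‖A c‖ ∧ ‖A c‖ ≤ 1 + δ / 2) (x : E) :
    (1 - δ) * ‖x‖ ≤ ‖A x‖ ∧ ‖A x‖ ≤ (1 + δ) * ‖x‖ := by
  obtain ⟨B, hB⟩ : ∃ B : E →L[ℝ] F, ∀ x, B x = A x := ⟨A.toContinuousLinearMap, fun _ => rfl⟩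
  simp only [← hB] at hA ⊢
  have hclose : ∀ y : E, ‖y‖ = 1 → ∃ c ∈ s, ‖B (y - c)‖ ≤ ‖B‖ * (δ / 4) := fun y hy => by
    obtain ⟨c, hc, hyc⟩ := hs y hy
    exact ⟨c, hc, (B.le_opNorm _).trans (by gcongr)⟩
  have hupper : ∀ y : E, ‖y‖ = 1 → ‖B y‖ ≤ 1 + δ / 2 + ‖B‖ * (δ / 4) := fun y hy => by
    obtain ⟨c, hc, hyc⟩ := hclose y hy
    calc ‖B y‖ = ‖B c + B (y - c)‖ := by rw [← map_add, add_sub_cancel]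
      _ ≤ ‖B c‖ + ‖B (y - c)‖ := norm_add_le _ _
      _ ≤ _ := add_le_add (hA c hc).2 hyc
  have hnormalize : ∀ y : E, y ≠ 0 → ‖B y‖ = ‖B (‖y‖⁻¹ • y)‖ * ‖y‖ := fun y hy => by
    have := norm_pos_iff.2 hy
    rw [map_smul, norm_smul, norm_inv, norm_norm]
    field_simp
  have hunit : ∀ y : E, y ≠ 0 → ‖(‖y‖⁻¹ • y)‖ = 1 := fun y hy => norm_smul_inv_norm (𝕜 := ℝ) hy
  -- The operator norm is bounded in terms of itself; solving uses `1 + δ / 2 ≤ (1 + δ) (1 - δ /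
  -- 4)`, valid as `δ ≤ 1`.
  have hnorm : ‖B‖ ≤ 1 + δ := by
    have hself : ‖B‖ ≤ 1 + δ / 2 + ‖B‖ * (δ / 4) := by
      refine B.opNorm_le_bound (by positivity) fun y => ?_
      rcases eq_or_ne y 0 with rfl | hy
      · simp
      · rw [hnormalize y hy]
        gcongr
        exact hupper _ (hunit y hy)
    by_contra! hlt
    nlinarith
  refine ⟨?_, (B.le_opNorm x).trans (by gcongr)⟩
  rcases eq_or_ne x 0 with rfl | hx
  · simp
  rw [hnormalize x hx]
  gcongr
  obtain ⟨c, hc, hxc⟩ := hclose _ (hunit x hx)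
  have htri : ‖B c‖ ≤ ‖B (‖x‖⁻¹ • x)‖ + ‖B (‖x‖⁻¹ • x - c)‖ := by
    rw [map_sub]
    exact norm_le_norm_add_norm_sub _ _
  have := (hA c hc).1
  nlinarith

end Nets

/-! ### Counting the admissible sets of groups. -/

section Combinatorics

/-- There are at most `(e m / g) ^ g` subsets of cardinality at most `g ≤ m` of a set with
`m` elements. -/
theorem card_filter_card_le_exp {m g : ℕ} (hgm : g ≤ m) :
    ((Finset.univ.filter fun S : Finset (Fin m) => S.card ≤ g).card : ℝ) ≤
      Real.exp ((g : ℝ) * Real.log (Real.exp 1 * m / g)) := by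
  rcases Nat.eq_zero_or_pos g with rfl | hg
  · simp [Finset.filter_eq', Finset.card_eq_zero]
  have hg0 : (0 : ℝ) < g := by exact_mod_cast hg
  have hm0 : (0 : ℝ) < m := by exact_mod_cast hg.trans_le hgm
  have hq0 : 0 < (g : ℝ) / m := by positivity
  have hq1 : (g : ℝ) / m ≤ 1 := (div_le_one hm0).2 (by exact_mod_cast hgm)
  have hexp : Real.exp ((g : ℝ) * Real.log (Real.exp 1 * m / g)) =
      Real.exp g / ((g : ℝ) / m) ^ g := by
    rw [Real.exp_nat_mul, Real.exp_log (by positivity), mul_div_assoc, mul_pow,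
      ← Real.exp_nat_mul, mul_one, div_eq_mul_inv _ (((g : ℝ) / m) ^ g), ← inv_pow, inv_div]
  -- Give each `S` the weight `(g / m) ^ |S|`, at least `(g / m) ^ g` when `|S| ≤ g`; the total over
  -- all `S` is `(1 + g / m) ^ m ≤ e ^ g`.
  rw [hexp, le_div_iff₀ (by positivity), ← nsmul_eq_mul, ← Finset.sum_const]
  calc ∑ S : Finset (Fin m) with S.card ≤ g, ((g : ℝ) / m) ^ g
      ≤ ∑ S : Finset (Fin m) with S.card ≤ g, ((g : ℝ) / m) ^ S.card :=
        Finset.sum_le_sum fun S hS =>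
          pow_le_pow_of_le_one hq0.le hq1 (Finset.mem_filter.1 hS).2
    _ ≤ ∑ S : Finset (Fin m), ((g : ℝ) / m) ^ S.card :=
        Finset.sum_le_sum_of_subset_of_nonneg (Finset.filter_subset _ _) fun _ _ _ => by positivity
    _ = ((g : ℝ) / m + 1) ^ m := by
        simpa using Fintype.sum_pow_mul_eq_add_pow (Fin m) ((g : ℝ) / m) 1
    _ ≤ Real.exp ((g : ℝ) / m) ^ m := by
        gcongr
        exact Real.add_one_le_exp _
    _ = Real.exp g := by
        rw [← Real.exp_nat_mul, mul_div_cancel₀ _ hm0.ne']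

end Combinatorics

/-! ### Chi-squared tails and Gaussian matrices. -/

section Gaussian

/-- The exponent is parametrized by the value `r` of the moment generating function; it is also the
optimal Chernoff exponent at level `n r ^ 2`, for the upper tail if `r > 1` and the lower if `r <
1`. -/
theorem mgf_sq_gaussianReal {r : ℝ} (hr : 0 < r) :
    mgf (fun x => x ^ 2) (gaussianReal 0 1) ((1 - (r ^ 2)⁻¹) / 2) = r := by
  rw [mgf, integral_gaussianReal_eq_integral_smul one_ne_zero]
  have hint : ∀ x : ℝ, gaussianPDFReal 0 1 x • Real.exp ((1 - (r ^ 2)⁻¹) / 2 * x ^ 2) =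
      (√(2 * Real.pi))⁻¹ * Real.exp (-(2 * r ^ 2)⁻¹ * x ^ 2) := fun x => by
    rw [gaussianPDFReal, smul_eq_mul, mul_assoc, ← Real.exp_add]
    simp only [NNReal.coe_one, mul_one, sub_zero]
    congr 2
    field_simp
    ring
  simp_rw [hint]
  rw [integral_const_mul, integral_gaussian, div_inv_eq_mul,
    show Real.pi * (2 * r ^ 2) = 2 * Real.pi * r ^ 2 by ring, Real.sqrt_mul (by positivity) (r ^ 2),
    Real.sqrt_sq hr.le, inv_mul_cancel_left₀ (by positivity)]

variable {Ω : Type*} [MeasurableSpace Ω] {P : Measure Ω}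

section ChiSquared

variable {n : ℕ} {Z : Fin n → Ω → ℝ}

theorem mgf_sum_sq_of_gaussianReal (hlaw : ∀ i, HasLaw (Z i) (gaussianReal 0 1) P)
    (hindep : iIndepFun Z P) {r : ℝ} (hr : 0 < r) :
    mgf (fun ω => ∑ i, Z i ω ^ 2) P ((1 - (r ^ 2)⁻¹) / 2) = r ^ n := by
  have hsum : (fun ω => ∑ i, Z i ω ^ 2) = ∑ i, fun ω => Z i ω ^ 2 := by
    ext ω
    simp
  have hindep' : iIndepFun (fun i ω => Z i ω ^ 2) P :=
    hindep.comp (fun _ x => x ^ 2) fun _ => by fun_prop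
  rw [hsum, hindep'.mgf_sum₀ fun i => (hlaw i).aemeasurable.pow_const 2]
  have hone : ∀ i, mgf (fun ω => Z i ω ^ 2) P ((1 - (r ^ 2)⁻¹) / 2) = r := fun i => by
    have h := mgf_sq_gaussianReal hr
    rwa [← (hlaw i).map_eq, mgf_map (hlaw i).aemeasurable (by fun_prop)] at h
  simp [hone]

theorem integrable_exp_sum_sq_of_gaussianReal (hlaw : ∀ i, HasLaw (Z i) (gaussianReal 0 1) P)
    (hindep : iIndepFun Z P) {r : ℝ} (hr : 0 < r) :
    Integrable (fun ω => Real.exp ((1 - (r ^ 2)⁻¹) / 2 * ∑ i, Z i ω ^ 2)) P := by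
  -- Otherwise the integral would be `0` by convention, but it equals `r ^ n > 0`.
  by_contra h
  have h0 := integral_undef h
  have h1 := mgf_sum_sq_of_gaussianReal hlaw hindep hr
  rw [mgf, h0] at h1
  exact (pow_pos hr n).ne h1

/-- The value of the Chernoff bound for a chi-squared variable at `n r²`. -/
theorem chernoff_chiSquared_eq (n : ℕ) {r : ℝ} (hr : 0 < r) :
    Real.exp (-((1 - (r ^ 2)⁻¹) / 2) * (n * r ^ 2)) * r ^ n =
      Real.exp (-(n * (r ^ 2 - 1 - 2 * Real.log r) / 2)) := by
  have hpow : r ^ n = Real.exp (n * Real.log r) := by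
    rw [Real.exp_nat_mul, Real.exp_log hr]
  rw [hpow, ← Real.exp_add]
  congr 1
  field_simp
  ring

theorem measureReal_sum_sq_ge_le (hlaw : ∀ i, HasLaw (Z i) (gaussianReal 0 1) P)
    (hindep : iIndepFun Z P) {ε : ℝ} (hε : 0 ≤ ε) :
    P.real {ω | n * (1 + ε) ^ 2 ≤ ∑ i, Z i ω ^ 2} ≤ Real.exp (-(n * ε ^ 2 / 2)) := by
  have := hindep.isProbabilityMeasure
  have hr : 0 < 1 + ε := by positivity
  have hs : 0 ≤ (1 - ((1 + ε) ^ 2)⁻¹) / 2 := by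
    have : ((1 + ε) ^ 2)⁻¹ ≤ 1 := inv_le_one_of_one_le₀ (by nlinarith)
    linarith
  refine (measure_ge_le_exp_mul_mgf _ hs
    (integrable_exp_sum_sq_of_gaussianReal hlaw hindep hr)).trans ?_
  rw [mgf_sum_sq_of_gaussianReal hlaw hindep hr, chernoff_chiSquared_eq n hr]
  -- With `r = 1 + ε`, this gives `r ^ 2 - 1 - 2 log r ≥ (r - 1) ^ 2 = ε ^ 2`; the lower tail uses
  -- `r = 1 - ε`.
  have := Real.log_le_sub_one_of_pos hr
  gcongr
  nlinarith

theorem measureReal_sum_sq_le_le (hlaw : ∀ i, HasLaw (Z i) (gaussianReal 0 1) P)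
    (hindep : iIndepFun Z P) {ε : ℝ} (hε : 0 ≤ ε) (hε1 : ε < 1) :
    P.real {ω | ∑ i, Z i ω ^ 2 ≤ n * (1 - ε) ^ 2} ≤ Real.exp (-(n * ε ^ 2 / 2)) := by
  have := hindep.isProbabilityMeasure
  have hr : 0 < 1 - ε := by linarith
  have hs : (1 - ((1 - ε) ^ 2)⁻¹) / 2 ≤ 0 := by
    have : 1 ≤ ((1 - ε) ^ 2)⁻¹ := (one_le_inv₀ (by positivity)).2 (by nlinarith)
    linarith
  refine (measure_le_le_exp_mul_mgf _ hs
    (integrable_exp_sum_sq_of_gaussianReal hlaw hindep hr)).trans ?_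
  rw [mgf_sum_sq_of_gaussianReal hlaw hindep hr, chernoff_chiSquared_eq n hr]
  have := Real.log_le_sub_one_of_pos hr
  gcongr
  nlinarith

end ChiSquared

variable {n p : ℕ} {X : Ω → Matrix (Fin n) (Fin p) ℝ}

theorem covariance_mulVec_of_gaussianReal
    (hlaw : ∀ i j, HasLaw (fun ω => X ω i j) (gaussianReal 0 1) P)
    (hindep : iIndepFun (fun (ij : Fin n × Fin p) ω => X ω ij.1 ij.2) P)
    (β : Fin p → ℝ) (i i' : Fin n) :
    cov[fun ω => (X ω *ᵥ β) i, fun ω => (X ω *ᵥ β) i'; P] =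
      if i = i' then ∑ j, β j ^ 2 else 0 := by
  have := hindep.isProbabilityMeasure
  have hmem : ∀ i j, MemLp (fun ω => X ω i j) 2 P := fun i j =>
    (hlaw i j).hasGaussianLaw.memLp_two
  have hentry : ∀ j j', cov[fun ω => X ω i j, fun ω => X ω i' j'; P] =
      if (i, j) = (i', j') then 1 else 0 := fun j j' => by
    split_ifs with h
    · obtain ⟨rfl, rfl⟩ := Prod.mk.inj h
      rw [covariance_self (hlaw i j).aemeasurable, (hlaw i j).variance_eq,
        variance_id_gaussianReal, NNReal.coe_one]
    · exact (hindep.indepFun h).covariance_eq_zero (hmem i j) (hmem i' j')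
  simp only [Matrix.mulVec, dotProduct]
  rw [covariance_fun_sum_fun_sum (fun j => (hmem i j).mul_const _)
    (fun j => (hmem i' j).mul_const _)]
  simp only [covariance_mul_const_left, covariance_mul_const_right, hentry, Prod.mk.injEq]
  split_ifs with h
  · simp [h, sq]
  · simp [h]

theorem hasGaussianLaw_mulVec
    (hlaw : ∀ i j, HasLaw (fun ω => X ω i j) (gaussianReal 0 1) P)
    (hindep : iIndepFun (fun (ij : Fin n × Fin p) ω => X ω ij.1 ij.2) P) (β : Fin p → ℝ) :
    HasGaussianLaw (fun ω i => (X ω *ᵥ β) i) P := by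
  have hX := iIndepFun.hasGaussianLaw (fun ij : Fin n × Fin p =>
    (hlaw ij.1 ij.2).hasGaussianLaw) hindep
  let L : (Fin n × Fin p → ℝ) →ₗ[ℝ] (Fin n → ℝ) :=
    { toFun := fun M i => ∑ j, M (i, j) * β j
      map_add' := fun M N => by ext i; simp [add_mul, Finset.sum_add_distrib]
      map_smul' := fun c M => by ext i; simp [mul_assoc, Finset.mul_sum] }
  exact hX.map_fun L.toContinuousLinearMap

/-- Coordinates of a jointly Gaussian vector are independent once uncorrelated. -/
theorem iIndepFun_mulVec
    (hlaw : ∀ i j, HasLaw (fun ω => X ω i j) (gaussianReal 0 1) P)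
    (hindep : iIndepFun (fun (ij : Fin n × Fin p) ω => X ω ij.1 ij.2) P) (β : Fin p → ℝ) :
    iIndepFun (fun i ω => (X ω *ᵥ β) i) P :=
  (hasGaussianLaw_mulVec hlaw hindep β).iIndepFun_of_covariance_eq_zero fun i i' h => by
    rw [covariance_mulVec_of_gaussianReal hlaw hindep, if_neg h]

theorem hasLaw_mulVec
    (hlaw : ∀ i j, HasLaw (fun ω => X ω i j) (gaussianReal 0 1) P)
    (hindep : iIndepFun (fun (ij : Fin n × Fin p) ω => X ω ij.1 ij.2) P) {β : Fin p → ℝ}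
    (hβ : ∑ j, β j ^ 2 = 1) (i : Fin n) :
    HasLaw (fun ω => (X ω *ᵥ β) i) (gaussianReal 0 1) P := by
  have hG := (hasGaussianLaw_mulVec hlaw hindep β).eval i
  refine ⟨hG.aemeasurable, ?_⟩
  have hmean : P[fun ω => (X ω *ᵥ β) i] = 0 := by
    simp only [Matrix.mulVec, dotProduct]
    rw [integral_finsetSum _ fun j _ => (hlaw i j).hasGaussianLaw.integrable.mul_const _]
    refine Finset.sum_eq_zero fun j _ => ?_
    rw [integral_mul_const, (hlaw i j).integral_eq, integral_id_gaussianReal, zero_mul]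
  rw [hG.map_eq_gaussianReal, hmean, ← covariance_self hG.aemeasurable,
    covariance_mulVec_of_gaussianReal hlaw hindep, if_pos rfl, hβ, Real.toNNReal_one]

/-- Concentration of the norm of a Gaussian matrix applied to a unit vector. -/
theorem measureReal_norm_euclideanMulVec_le (hn : 0 < n)
    (hlaw : ∀ i j, HasLaw (fun ω => X ω i j) (gaussianReal 0 1) P)
    (hindep : iIndepFun (fun (ij : Fin n × Fin p) ω => X ω ij.1 ij.2) P)
    {β : EuclideanSpace ℝ (Fin p)} (hβ : ‖β‖ = 1) {ε : ℝ} (hε : 0 ≤ ε) (hε1 : ε < 1) :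
    P.real {ω | ¬(1 - ε ≤ 1 / √(n : ℝ) * ‖euclideanMulVec (X ω) β‖ ∧
      1 / √(n : ℝ) * ‖euclideanMulVec (X ω) β‖ ≤ 1 + ε)} ≤
      2 * Real.exp (-(n * ε ^ 2 / 2)) := by
  have := hindep.isProbabilityMeasure
  have hn' : (0 : ℝ) < n := by exact_mod_cast hn
  have hβ' : ∑ j, β j ^ 2 = 1 := by
    rw [← EuclideanSpace.real_norm_sq_eq, hβ, one_pow]
  have hZ := hasLaw_mulVec hlaw hindep hβ'
  have hZi := iIndepFun_mulVec hlaw hindep fun j => β j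
  have hnorm : ∀ ω, ∑ i, (X ω *ᵥ fun j => β j) i ^ 2 =
      n * (1 / √(n : ℝ) * ‖euclideanMulVec (X ω) β‖) ^ 2 := fun ω => by
    rw [mul_pow, EuclideanSpace.real_norm_sq_eq, div_pow, Real.sq_sqrt hn'.le, one_pow,
      ← mul_assoc, mul_one_div_cancel hn'.ne', one_mul]
    rfl
  have hsub : {ω | ¬(1 - ε ≤ 1 / √(n : ℝ) * ‖euclideanMulVec (X ω) β‖ ∧
      1 / √(n : ℝ) * ‖euclideanMulVec (X ω) β‖ ≤ 1 + ε)} ⊆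
      {ω | ∑ i, (X ω *ᵥ fun j => β j) i ^ 2 ≤ n * (1 - ε) ^ 2} ∪
      {ω | n * (1 + ε) ^ 2 ≤ ∑ i, (X ω *ᵥ fun j => β j) i ^ 2} := by
    intro ω hω
    simp only [Set.mem_union, Set.mem_ofPred_eq, hnorm] at hω ⊢
    have h0 : 0 ≤ 1 / √(n : ℝ) * ‖euclideanMulVec (X ω) β‖ := by positivity
    rcases not_and_or.1 hω with h | h
    · left
      gcongr
      exact (not_le.1 h).le
    · right
      gcongr
      exact (not_le.1 h).le
  calc _ ≤ _ := measureReal_mono hsub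
    _ ≤ _ := measureReal_union_le _ _
    _ ≤ _ := add_le_add (measureReal_sum_sq_le_le hZ hZi hε hε1)
      (measureReal_sum_sq_ge_le hZ hZi hε)
    _ = _ := (two_mul _).symm

end Gaussian

/-! ### Coordinate subspaces and reduction to nets. -/

section Sparse

/-- The subspace of vectors supported in `T`. -/
def supportedSubspace {p : ℕ} (T : Finset (Fin p)) : Submodule ℝ (EuclideanSpace ℝ (Fin p)) where
  carrier := {β | ∀ i ∉ T, β i = 0}
  add_mem' ha hb i hi := by simp [ha i hi, hb i hi]
  zero_mem' i _ := rfl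
  smul_mem' c a ha i hi := by simp [ha i hi]

theorem finrank_supportedSubspace_le {p : ℕ} (T : Finset (Fin p)) :
    Module.finrank ℝ (supportedSubspace T) ≤ T.card := by
  let restrict : supportedSubspace T →ₗ[ℝ] (T → ℝ) :=
    { toFun := fun β i => β.1 i
      map_add' := fun _ _ => rfl
      map_smul' := fun _ _ => rfl }
  have hinj : Function.Injective restrict := fun a b hab => by
    ext i
    by_cases hi : i ∈ T
    · exact congrFun hab ⟨i, hi⟩
    · rw [a.2 i hi, b.2 i hi]
  simpa using LinearMap.finrank_le_finrank_of_injective hinj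

/-- The normalized map `β ↦ A β / √n`. -/
noncomputable def normalizedMulVec {n p : ℕ} (A : Matrix (Fin n) (Fin p) ℝ) :
    EuclideanSpace ℝ (Fin p) →ₗ[ℝ] EuclideanSpace ℝ (Fin n) where
  toFun β := (1 / √(n : ℝ)) • euclideanMulVec A β
  map_add' a b := by
    rw [← smul_add]
    congr 1
    ext i
    exact congrFun (A.mulVec_add (fun j => a j) fun j => b j) i
  map_smul' c a := by
    rw [RingHom.id_apply, smul_comm c]
    congr 1
    ext i
    exact congrFun (A.mulVec_smul c fun j => a j) i

theorem norm_normalizedMulVec {n p : ℕ} (A : Matrix (Fin n) (Fin p) ℝ)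
    (β : EuclideanSpace ℝ (Fin p)) :
    ‖normalizedMulVec A β‖ = 1 / √(n : ℝ) * ‖euclideanMulVec A β‖ := by
  change ‖(1 / √(n : ℝ)) • euclideanMulVec A β‖ = _
  rw [norm_smul, Real.norm_of_nonneg (by positivity)]

/-- If `A / √n` is a `δ / 2`-almost isometry on a `δ / 4`-net of the unit sphere of each of the
coordinate subspaces involved, then `A` satisfies the group-RIP inequality. -/
theorem groupRIP_of_nets {n p m : ℕ} {G : Fin m → Finset (Fin p)} {g k : ℕ} {δ : ℝ}
    (hδ0 : 0 < δ) (hδ1 : δ < 1) {A : Matrix (Fin n) (Fin p) ℝ}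
    {net : ∀ T : Finset (Fin p), Finset (supportedSubspace T)}
    (hnet : ∀ T, ∀ x : supportedSubspace T, ‖x‖ = 1 → ∃ c ∈ net T, ‖x - c‖ ≤ δ / 4)
    (hA : ∀ S : Finset (Fin m), S.card ≤ g → (groupUnion G S).card ≤ k →
      ∀ c ∈ net (groupUnion G S), 1 - δ / 2 ≤ 1 / √(n : ℝ) * ‖euclideanMulVec A c‖ ∧
        1 / √(n : ℝ) * ‖euclideanMulVec A c‖ ≤ 1 + δ / 2) :
    GroupRIP G g k δ A := by
  rintro β ⟨S, hsupp, hk, hg⟩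
  have hβ : β ∈ supportedSubspace (groupUnion G S) := fun i hi => by
    by_contra h
    exact hi (hsupp h)
  have := almostIsometry_of_net hδ0 hδ1
    ((normalizedMulVec A).comp (supportedSubspace (groupUnion G S)).subtype)
    (s := (net (groupUnion G S) : Set _)) (hnet _)
    (fun c hc => by simpa [norm_normalizedMulVec] using hA S hg hk c hc) ⟨β, hβ⟩
  simpa [norm_normalizedMulVec] using this

end Sparse

theorem proposition3 {Ω : Type*} [MeasurableSpace Ω] (P : Measure Ω) [IsProbabilityMeasure P]
    (n p m : ℕ) (G : Fin m → Finset (Fin p))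
    (hdisj : ∀ i j, i ≠ j → Disjoint (G i) (G j))
    (hcover : groupUnion G Finset.univ = Finset.univ)
    (X : Ω → Matrix (Fin n) (Fin p) ℝ)
    (hlaw : ∀ i j, HasLaw (fun ω => X ω i j) (gaussianReal 0 1) P)
    (hindep : iIndepFun (fun (ij : Fin n × Fin p) ω => X ω ij.1 ij.2) P)
    (g k : ℕ) (hgm : g ≤ m) (t δ : ℝ) (ht : 0 < t) (hδ0 : 0 < δ) (hδ1 : δ < 1)
    (hn : 8 / δ ^ 2 * (Real.log 3 + t + (k : ℝ) * Real.log (1 + 8 / δ)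
        + (g : ℝ) * Real.log (Real.exp 1 * (m : ℝ) / (g : ℝ))) ≤ (n : ℝ)) :
    1 - Real.exp (-t) ≤ P.real {ω | GroupRIP G g k δ (X ω)} := by
  have hnets : ∀ T : Finset (Fin p), ∃ s : Finset (supportedSubspace T), (∀ c ∈ s, ‖c‖ = 1) ∧
      (∀ x, ‖x‖ = 1 → ∃ c ∈ s, ‖x - c‖ ≤ δ / 4) ∧ (s.card : ℝ) ≤ (1 + 8 / δ) ^ T.card := by
    intro T
    obtain ⟨s, hs, hnet, hcard⟩ :=
      exists_finset_net_unitSphere (E := supportedSubspace T) (ε := δ / 4) (by positivity)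
    refine ⟨s, hs, hnet, hcard.trans ?_⟩
    rw [show 2 / (δ / 4) = 8 / δ by field_simp; norm_num]
    exact pow_le_pow_right₀ (le_add_of_nonneg_right (by positivity))
      (finrank_supportedSubspace_le T)
  choose net hunit hnet hcard using hnets
  let family : Finset (Finset (Fin m)) :=
    Finset.univ.filter fun S => S.card ≤ g ∧ (groupUnion G S).card ≤ k
  let bad : EuclideanSpace ℝ (Fin p) → Set Ω := fun β =>
    {ω | ¬(1 - δ / 2 ≤ 1 / √(n : ℝ) * ‖euclideanMulVec (X ω) β‖ ∧
      1 / √(n : ℝ) * ‖euclideanMulVec (X ω) β‖ ≤ 1 + δ / 2)}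
  have hcount : (family.card : ℝ) ≤
      Real.exp ((g : ℝ) * Real.log (Real.exp 1 * (m : ℝ) / (g : ℝ))) := by
    refine le_trans ?_ (card_filter_card_le_exp hgm)
    exact_mod_cast Finset.card_le_card fun S hS => by
      simp only [family, Finset.mem_filter] at hS ⊢
      exact ⟨hS.1, hS.2.1⟩
  -- The empty set is always counted, so the exponential is at least `1`.
  have hcount0 : 0 ≤ (g : ℝ) * Real.log (Real.exp 1 * (m : ℝ) / (g : ℝ)) := by
    rw [← Real.one_le_exp_iff]
    refine le_trans ?_ (card_filter_card_le_exp hgm)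
    exact_mod_cast Finset.card_pos.2 ⟨∅, by simp⟩
  have hbase : 0 < 1 + 8 / δ := by positivity
  have hlog : 0 ≤ Real.log (1 + 8 / δ) :=
    Real.log_nonneg (le_add_of_nonneg_right (by positivity))
  have hlog3 : 0 < Real.log 3 := Real.log_pos (by norm_num)
  have hn0 : 0 < n := by
    have : (0 : ℝ) < n := lt_of_lt_of_le (by positivity) hn
    exact_mod_cast this
  have hbad : ∀ S ∈ family, ∀ c ∈ net (groupUnion G S),
      P.real (bad c) ≤ 2 * Real.exp (-(n * (δ / 2) ^ 2 / 2)) := fun S _ c hc =>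
    measureReal_norm_euclideanMulVec_le hn0 hlaw hindep (hunit _ c hc) (by positivity)
      (by linarith)
  have hunion : P.real (⋃ S ∈ family, ⋃ c ∈ net (groupUnion G S), bad c) ≤ Real.exp (-t) := by
    calc P.real (⋃ S ∈ family, ⋃ c ∈ net (groupUnion G S), bad c)
        ≤ ∑ S ∈ family, ∑ c ∈ net (groupUnion G S), P.real (bad c) :=
          (measureReal_biUnion_finset_le _ _).trans
            (Finset.sum_le_sum fun S _ => measureReal_biUnion_finset_le _ _)
      _ ≤ ∑ S ∈ family, (1 + 8 / δ) ^ k * (2 * Real.exp (-(n * (δ / 2) ^ 2 / 2))) := by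
          refine Finset.sum_le_sum fun S hS => ?_
          refine (Finset.sum_le_card_nsmul _ _ _ (hbad S hS)).trans ?_
          rw [nsmul_eq_mul]
          gcongr
          exact (hcard _).trans (pow_le_pow_right₀ (le_add_of_nonneg_right (by positivity))
            (Finset.mem_filter.1 hS).2.2)
      _ ≤ Real.exp ((g : ℝ) * Real.log (Real.exp 1 * (m : ℝ) / (g : ℝ))) *
            (Real.exp (k * Real.log (1 + 8 / δ)) *
              (Real.exp (Real.log 3) * Real.exp (-(n * (δ / 2) ^ 2 / 2)))) := by
          rw [Finset.sum_const, nsmul_eq_mul, Real.exp_nat_mul _ k, Real.exp_log hbase,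
            Real.exp_log (by norm_num : (0 : ℝ) < 3)]
          gcongr
          norm_num
      _ ≤ Real.exp (-t) := by
          -- The factor `2` was relaxed to `3 = exp (log 3)`, and `n (δ / 2) ^ 2 / 2 = n δ ^ 2 / 8`
          -- matches the constant `8 / δ ^ 2`.
          rw [← Real.exp_add, ← Real.exp_add, ← Real.exp_add, Real.exp_le_exp]
          rw [div_mul_eq_mul_div, div_le_iff₀ (by positivity)] at hn
          linarith
  have hgood : (⋃ S ∈ family, ⋃ c ∈ net (groupUnion G S), bad c)ᶜ ⊆
      {ω | GroupRIP G g k δ (X ω)} := by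
    intro ω hω
    refine groupRIP_of_nets hδ0 hδ1 hnet fun S hg hk c hc => ?_
    by_contra h
    refine hω (Set.mem_biUnion (x := S) ?_ (Set.mem_biUnion (x := c) hc h))
    simp [family, hg, hk]
  -- Subadditivity suffices, so no event has to be shown measurable.
  have hcompl := measureReal_union_le (μ := P)
    (⋃ S ∈ family, ⋃ c ∈ net (groupUnion G S), bad c)
    (⋃ S ∈ family, ⋃ c ∈ net (groupUnion G S), bad c)ᶜ
  rw [Set.union_compl_self, probReal_univ] at hcompl
  have := measureReal_mono (μ := P) hgood
  linarith
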